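/- For $n\in\mathbb{Z}_{\ge 0}$ and a positive integer $h$, let $$S_n^{(h)}(x)=\sum_{i=0}^{n}\binom{n+i}{2i}^{h}C_i^{h}\,x^{i},\qquad C_i=\frac{1}{i+1}\binom{2i}{i},$$ be the generalized Schröder polynomial, and let $(b_1,\dots,b_r)$ denote the greatest common divisor of the nonnegative integers $b_1,\dots,b_r$, not all zero (with $(b,0)=b$ for $b>0$). Then for all positive integers $h,m,n,a$, $$\frac{(2,n)}{n(n+1)(n+2)}\sum_{k=1}^{n}k^{a}(k+1)^{a}(2k+1)\,S_k^{(h)}(x)^{m}\in\mathbb{Z}[x]$$ and $$\frac{(2,m-1,n)}{n(n+1)(n+2)}\sum_{k=1}^{n}(-1)^{k}k^{a}(k+1)^{a}(2k+1)\,S_k^{(h)}(x)^{m}\in\mathbb{Z}[x].$$ -/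

import Mathlib

open Polynomial

/-- The generalized (large) Schröder polynomial
`S_n^{(h)}(x) = ∑_{i=0}^{n} binom(n+i, 2i)^h * C_i^h * x^i`, where `C_i` is the `i`-th Catalan
number. -/
noncomputable def genSchroderPoly (h n : ℕ) : ℤ[X] :=
  ∑ i ∈ Finset.range (n + 1),
    C ((((n + i).choose (2 * i)) ^ h * (catalan i) ^ h : ℕ) : ℤ) * X ^ i

/-- The subring `ℤ[x]` of `ℚ[x]`: the polynomials all of whose coefficients are integers. -/
noncomputable def intPolySubring : Subring ℚ[X] :=
  (Polynomial.mapRingHom (Int.castRingHom ℚ)).range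

/-! As functions of k, the `schroderCoeff i` are the products ∏_{j<i} (k(k+1) - j(j+1)) divided by
i!(i+1)!. Their ℤ[x]-span is closed under multiplication (`exists_schroderCoeff_mul_eq`), so it
contains (k(k+1))^(a-1) S_k^m for k ≤ n. By linearity, divisibility of the weighted sums need only
be checked on the basis, where the sums telescope to closed forms.

The plain sum is n(n+1)(n+2)/2 times an integer that is even for odd n. The alternating sum is
±n(n+1)(n+2)/2 times W_i + W_{i+1} (`alternatingWeight`), where every W_i is even if n is odd. If n
is even, the missing 2 comes from k(k+1) when a > 1. When a = 1 and m is even, the summand is a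
square in the span: squaring is additive modulo 2, which leaves the squares of basis functions,
expanded in `schroderCoeff_sq`. For n even and m odd the gcd itself provides the 2. -/

/-- The product `∏_{j<i} (k(k+1) - j(j+1))`. -/
def pronicProd (i k : ℕ) : ℤ := ∏ j ∈ Finset.range i, (((k : ℤ) - j) * (k + j + 1))

/-- The product `∏_{1 ≤ j ≤ i} ((n+1)^2 - j^2)`. -/
def squareProd (i n : ℕ) : ℤ := ∏ j ∈ Finset.range i, (((n : ℤ) - j) * (n + j + 2))

/-- The coefficient `binom(k+i, 2i) C_i` of the Schröder polynomial `S_k`. -/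
def schroderCoeff (i k : ℕ) : ℤ := (k + i).choose (2 * i) * catalan i

/-! ### Telescoping sums of pronic products -/

theorem pronicProd_succ (i k : ℕ) :
    pronicProd (i + 1) k = pronicProd i k * (((k : ℤ) - i) * (k + i + 1)) :=
  Finset.prod_range_succ _ _

theorem squareProd_succ (i n : ℕ) :
    squareProd (i + 1) n = squareProd i n * (((n : ℤ) - i) * (n + i + 2)) :=
  Finset.prod_range_succ _ _

/-- With its primed companion, this expresses the closed forms at n + 1 and at n through the same
`pronicProd i (n + 1)`, so each induction step below is a polynomial identity. -/
theorem succ_mul_squareProd (i n : ℕ) :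
    ((n : ℤ) + 1) * squareProd i n = (n + i + 1) * pronicProd i n := by
  induction i with
  | zero => simp [squareProd, pronicProd]
  | succ i ih =>
    rw [squareProd_succ, pronicProd_succ, ← mul_assoc, ih]; push_cast; ring

theorem succ_mul_squareProd' (i n : ℕ) :
    ((n : ℤ) + 1) * squareProd i n = (n + 1 - i) * pronicProd i (n + 1) := by
  induction i with
  | zero => simp [squareProd, pronicProd]
  | succ i ih =>
    rw [squareProd_succ, pronicProd_succ, ← mul_assoc, ih]; push_cast; ring

theorem sum_pronicProd (i n : ℕ) :
    ((i : ℤ) + 2) * ∑ k ∈ Finset.range (n + 1), (k : ℤ) * (k + 1) * (2 * k + 1) * pronicProd i k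
      = n * (n + 2) * (n + 1) * ((n + 1) * squareProd i n) := by
  induction n with
  | zero => simp
  | succ n ih =>
    rw [Finset.sum_range_succ, mul_add, ih, succ_mul_squareProd', succ_mul_squareProd]
    push_cast; ring

theorem alternating_sum_pronicProd (i n : ℕ) :
    ∑ k ∈ Finset.range (n + 1), (-1) ^ k * ((k : ℤ) * (k + 1) * (2 * k + 1)) * pronicProd i k
      = (-1) ^ n * (((n + 1) * squareProd i n) * (n * (n + 2) - i)) := by
  induction n with
  | zero => rcases i with _ | i <;> simp [squareProd, Finset.prod_range_succ']
  | succ n ih =>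
    rw [Finset.sum_range_succ, ih, succ_mul_squareProd', succ_mul_squareProd]
    push_cast; ring

/-! ### Catalan normalization and the plain sum -/

theorem factorial_mul_catalan (i : ℕ) :
    (i.factorial * (i + 1).factorial) * catalan i = (2 * i).factorial := by
  have h := succ_mul_catalan_eq_centralBinom i
  have h2 := Nat.choose_mul_factorial_mul_factorial (show i ≤ 2 * i by omega)
  rw [Nat.centralBinom] at h
  rw [show 2 * i - i = i by omega, ← h] at h2
  rw [← h2, Nat.factorial_succ]; ring

theorem factorial_mul_choose_eq_pronicProd (i k : ℕ) :
    ((2 * i).factorial : ℤ) * (k + i).choose (2 * i) = pronicProd i k := by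
  induction i with
  | zero => simp [pronicProd]
  | succ i ih =>
    rw [pronicProd_succ, ← ih]
    rcases le_or_gt i k with h | h
    · obtain ⟨t, rfl⟩ := Nat.exists_eq_add_of_le h
      have h1 := Nat.choose_mul_succ_eq (i + t + i) (2 * i)
      rw [show i + t + i + 1 - 2 * i = t + 1 by omega] at h1
      have h2 := Nat.choose_succ_right_eq (i + t + i + 1) (2 * i)
      rw [show i + t + i + 1 - 2 * i = t + 1 by omega, ← h1] at h2
      have h3 := Nat.choose_succ_right_eq (i + t + i + 1) (2 * i + 1)
      rw [show i + t + i + 1 - (2 * i + 1) = t by omega] at h3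
      have h4 : ((2 * i).factorial : ℤ) * ((i + t + i + 1).choose (2 * i + 1 + 1) * (2 * i + 1 + 1))
          * (2 * i + 1) = (2 * i).factorial * ((i + t + i).choose (2 * i) * (i + t + i + 1)) * t := by
        have h3' : ((i + t + i + 1).choose (2 * i + 1 + 1) : ℤ) * (2 * i + 1 + 1)
          = (i + t + i + 1).choose (2 * i + 1) * t := by exact_mod_cast h3
        have h2' : ((i + t + i + 1).choose (2 * i + 1) : ℤ) * (2 * i + 1)
          = (i + t + i).choose (2 * i) * (i + t + i + 1) := by exact_mod_cast h2
        rw [h3', ← h2']; ring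
      rw [show 2 * (i + 1) = 2 * i + 1 + 1 by ring, show i + t + (i + 1) = i + t + i + 1 by ring,
        Nat.factorial_succ, Nat.factorial_succ]
      push_cast
      linear_combination h4
    · rw [Nat.choose_eq_zero_of_lt (show k + i < 2 * i by omega),
        Nat.choose_eq_zero_of_lt (show k + (i + 1) < 2 * (i + 1) by omega)]
      simp

theorem factorial_mul_schroderCoeff (i k : ℕ) :
    ((i.factorial * (i + 1).factorial : ℕ) : ℤ) * schroderCoeff i k = pronicProd i k := by
  rw [← factorial_mul_choose_eq_pronicProd, ← factorial_mul_catalan, schroderCoeff]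
  push_cast; ring

theorem factorial_mul_choose_eq_squareProd (i n : ℕ) :
    ((2 * i + 1).factorial : ℤ) * (n + 1 + i).choose (2 * i + 1) = (n + 1) * squareProd i n := by
  rw [succ_mul_squareProd, ← factorial_mul_choose_eq_pronicProd]
  have h := Nat.add_one_mul_choose_eq (n + i) (2 * i)
  have h' : ((n : ℤ) + i + 1) * (n + i).choose (2 * i)
    = (n + 1 + i).choose (2 * i + 1) * (2 * i + 1) := by
    rw [show n + 1 + i = n + i + 1 by ring]; exact_mod_cast h
  rw [Nat.factorial_succ]; push_cast
  linear_combination (-((2 * i).factorial : ℤ)) * h'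

/-- The 2 completes the factorials left over from `sum_pronicProd` to a Catalan number:
2(2i+1)!/(i!(i+1)!(i+2)) = C_{i+1}. -/
theorem two_mul_sum_schroderCoeff (i n : ℕ) :
    2 * ∑ k ∈ Finset.range (n + 1), (k : ℤ) * (k + 1) * (2 * k + 1) * schroderCoeff i k
      = n * (n + 1) * (n + 2) * ((n + 1 + i).choose (2 * i + 1) * catalan (i + 1)) := by
  have h := sum_pronicProd i n
  simp_rw [← factorial_mul_schroderCoeff, mul_left_comm _ ((_ : ℕ) : ℤ) (schroderCoeff _ _),
    ← Finset.mul_sum] at h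
  rw [← factorial_mul_choose_eq_squareProd] at h
  have hc := factorial_mul_catalan (i + 1)
  rw [show 2 * (i + 1) = 2 * i + 1 + 1 by ring, Nat.factorial_succ (2 * i + 1),
    Nat.factorial_succ (i + 1), Nat.factorial_succ i] at hc
  have hc' : ((i : ℤ) + 1) * i.factorial * ((i + 1 + 1) * ((i + 1) * i.factorial)) * catalan (i + 1)
    = (2 * i + 1 + 1) * (2 * i + 1).factorial := by exact_mod_cast hc
  rw [Nat.factorial_succ i] at h
  push_cast at h
  have h0 : ((i : ℤ) + 1) * ((i.factorial : ℤ) * ((i + 1) * i.factorial) * (i + 2)) ≠ 0 := by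
    have := Nat.factorial_pos i
    positivity
  apply mul_left_cancel₀ h0
  linear_combination 2 * ((i : ℤ) + 1) * h
    - n * (n + 1) * (n + 2) * ((n + 1 + i).choose (2 * i + 1) : ℤ) * hc'

/-- In (i+1) C_i = binom(2i, i) the right side is even and i+1 is odd. -/
theorem even_catalan {i : ℕ} (hi : Even i) (h0 : i ≠ 0) : Even (catalan i) := by
  obtain ⟨q, rfl⟩ := hi
  obtain ⟨q, rfl⟩ : ∃ r, q = r + 1 := ⟨q - 1, by omega⟩
  have h := succ_mul_catalan_eq_centralBinom (q + 1 + (q + 1))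
  have h2 : Even (Nat.centralBinom (q + 1 + (q + 1))) :=
    even_iff_two_dvd.2 (Nat.two_dvd_centralBinom_of_one_le (by omega))
  rw [← h, Nat.even_mul] at h2
  rcases h2 with h2 | h2
  · grind
  · exact h2

theorem even_choose_of_even_of_odd {a b : ℕ} (ha : Even a) (hb : Odd b) : Even (a.choose b) := by
  obtain ⟨c, rfl⟩ := hb
  rcases a with _ | a
  · rw [Nat.choose_eq_zero_of_lt (by omega)]; exact Even.zero
  · have h := Nat.add_one_mul_choose_eq a (2 * c)
    have : Even ((a + 1).choose (2 * c + 1) * (2 * c + 1)) := h ▸ ha.mul_right _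
    rw [Nat.even_mul] at this
    rcases this with h | h
    · exact h
    · exact absurd h (by simp)

theorem dvd_gcd_mul_sum_schroderCoeff (i n : ℕ) :
    ((n : ℤ) * (n + 1) * (n + 2)) ∣ (Nat.gcd 2 n : ℕ) *
      ∑ k ∈ Finset.range (n + 1), (k : ℤ) * (k + 1) * (2 * k + 1) * schroderCoeff i k := by
  have h := two_mul_sum_schroderCoeff i n
  rcases Nat.even_or_odd n with hn | hn
  · rw [Nat.gcd_eq_left (even_iff_two_dvd.1 hn)]
    exact ⟨_, h⟩
  · have he : Even ((n + 1 + i).choose (2 * i + 1) * catalan (i + 1)) := by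
      rw [Nat.even_mul]
      rcases Nat.even_or_odd i with hi | hi
      · exact Or.inl (even_choose_of_even_of_odd (by grind) (by grind))
      · exact Or.inr (even_catalan (by grind) (by omega))
    obtain ⟨c, hc⟩ := even_iff_two_dvd.1 he
    have hc' : ((n + 1 + i).choose (2 * i + 1) * catalan (i + 1) : ℤ) = 2 * c := by
      exact_mod_cast hc
    refine Dvd.dvd.mul_left (Dvd.intro (c : ℤ) ?_) _
    rw [hc'] at h
    linarith

/-! ### The alternating sum -/

/-- `V_i = (i-1)!^{-2} ∏_{2 ≤ j ≤ i} ((n+1)^2 - j^2)` for `i = q + 1` and `n = r + 1`. -/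
def truncSquareQuot (q r : ℕ) : ℤ := r.choose q * (r + 3 + q).choose q

theorem truncSquareQuot_succ (q r : ℕ) :
    ((q : ℤ) + 1) ^ 2 * truncSquareQuot (q + 1) r
      = (r - q) * (r + q + 4) * truncSquareQuot q r := by
  have h1 : (r.choose (q + 1) : ℤ) * (q + 1) = r.choose q * (r - q) := by
    rcases le_or_gt q r with h | h
    · have := Nat.choose_succ_right_eq r q
      rw [← Nat.cast_sub h]; exact_mod_cast this
    · simp [Nat.choose_eq_zero_of_lt h, Nat.choose_eq_zero_of_lt (h.trans (Nat.lt_succ_self q))]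
  have h2 : ((r : ℤ) + q + 4) * (r + 3 + q).choose q = (r + 3 + (q + 1)).choose (q + 1) * (q + 1) := by
    have := Nat.add_one_mul_choose_eq (r + 3 + q) q
    rw [show r + 3 + (q + 1) = r + 3 + q + 1 by ring,
      show (r : ℤ) + q + 4 = r + 3 + q + 1 by ring]
    exact_mod_cast this
  rw [truncSquareQuot, truncSquareQuot]
  linear_combination ((r + 3 + (q + 1)).choose (q + 1) : ℤ) * (q + 1) * h1
    - r.choose q * (r - q : ℤ) * h2

theorem squareProd_eq_truncSquareQuot (q r : ℕ) :
    squareProd (q + 1) (r + 1) = (r + 1) * (r + 3) * ((q.factorial : ℤ) ^ 2 * truncSquareQuot q r) := by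
  induction q with
  | zero => simp [squareProd, truncSquareQuot]; left; ring
  | succ q ih =>
    rw [squareProd_succ, ih, Nat.factorial_succ]
    push_cast
    linear_combination (-(r + 1) * (r + 3) * (q.factorial : ℤ) ^ 2) * truncSquareQuot_succ q r

theorem dvd_mul_truncSquareQuot (q r : ℕ) : ((q : ℤ) + 1) ∣ (r + 1) * truncSquareQuot q r := by
  have := Nat.add_one_mul_choose_eq r q
  refine ⟨(r + 1).choose (q + 1) * (r + 3 + q).choose q, ?_⟩
  have h' : ((r : ℤ) + 1) * r.choose q = (r + 1).choose (q + 1) * (q + 1) := by exact_mod_cast this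
  rw [truncSquareQuot]
  linear_combination ((r + 3 + q).choose q : ℤ) * h'

/-- The number q+1 divides both (r+1)V and (r+3)V, hence their difference. -/
theorem dvd_two_mul_truncSquareQuot (q r : ℕ) : ((q : ℤ) + 1) ∣ 2 * truncSquareQuot q r := by
  have h := Nat.choose_succ_right_eq (r + 3 + q) q
  rw [show r + 3 + q - q = r + 3 by omega] at h
  have h' : ((r + 3 + q).choose (q + 1) : ℤ) * (q + 1) = (r + 3 + q).choose q * (r + 3) := by
    exact_mod_cast h
  have h3 : ((q : ℤ) + 1) ∣ (r + 3) * truncSquareQuot q r := by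
    refine ⟨r.choose q * (r + 3 + q).choose (q + 1), ?_⟩
    rw [truncSquareQuot]
    linear_combination (-(r.choose q : ℤ)) * h'
  have := dvd_sub h3 (dvd_mul_truncSquareQuot q r)
  rwa [← sub_mul, show ((r : ℤ) + 3) - (r + 1) = 2 by ring] at this

/-- `2 V_i / i`, with value `0` at `i = 0`. -/
def alternatingWeight (r : ℕ) : ℕ → ℤ
  | 0 => 0
  | q + 1 => 2 * truncSquareQuot q r / (q + 1)

theorem mul_alternatingWeight (r q : ℕ) :
    ((q : ℤ) + 1) * alternatingWeight r (q + 1) = 2 * truncSquareQuot q r :=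
  Int.mul_ediv_cancel' (dvd_two_mul_truncSquareQuot q r)

theorem even_alternatingWeight_of_odd (r : ℕ) {i : ℕ} (hi : Odd i) :
    (2 : ℤ) ∣ alternatingWeight r i := by
  obtain ⟨q, rfl⟩ := hi
  have h := mul_alternatingWeight r (2 * q)
  push_cast at h
  exact ⟨truncSquareQuot (2 * q) r - q * alternatingWeight r (2 * q + 1), by linarith⟩

/-- Since r+1 is odd, divisibility of both (r+1)V and 2V by q+1 gives divisibility of V itself. -/
theorem even_alternatingWeight_of_even {r : ℕ} (hr : Even r) (i : ℕ) :
    (2 : ℤ) ∣ alternatingWeight r i := by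
  rcases i with _ | q
  · exact dvd_zero _
  obtain ⟨t, rfl⟩ := hr
  obtain ⟨c, hc⟩ := dvd_two_mul_truncSquareQuot q (t + t)
  obtain ⟨d, hd⟩ := dvd_mul_truncSquareQuot q (t + t)
  have h := mul_alternatingWeight (t + t) q
  have h0 : (q : ℤ) + 1 ≠ 0 := by positivity
  have hw : alternatingWeight (t + t) (q + 1) = c := mul_left_cancel₀ h0 (h.trans hc)
  push_cast at hd
  refine ⟨d - t * c, mul_left_cancel₀ h0 ?_⟩
  rw [hw]
  linear_combination (-1 - 2 * t : ℤ) * hc + 2 * hd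

/-- With n = r+1, split n(n+2) - i = ((n+1)^2 - (i+1)^2) + i(i+1): after normalization the two parts
give V_{i+1}/(i+1) and V_i/i. -/
theorem two_mul_alternating_sum_schroderCoeff (i r : ℕ) :
    2 * ∑ k ∈ Finset.range (r + 1 + 1),
        (-1) ^ k * ((k : ℤ) * (k + 1) * (2 * k + 1)) * schroderCoeff i k
      = (-1) ^ (r + 1) * (((r : ℤ) + 1) * (r + 2) * (r + 3)) *
        (alternatingWeight r i + alternatingWeight r (i + 1)) := by
  have h := alternating_sum_pronicProd i (r + 1)
  simp_rw [← factorial_mul_schroderCoeff, mul_left_comm _ ((_ : ℕ) : ℤ) (schroderCoeff _ _),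
    ← Finset.mul_sum] at h
  have h1 := mul_alternatingWeight r i
  rcases i with _ | q
  · simp [squareProd, truncSquareQuot, alternatingWeight] at h h1 ⊢
    rw [h]; ring
  have h2 := mul_alternatingWeight r q
  have h3 := truncSquareQuot_succ q r
  rw [squareProd_eq_truncSquareQuot, Nat.factorial_succ, Nat.factorial_succ] at h
  rw [Nat.factorial_succ] at h
  push_cast at h h1
  have h0 : ((q : ℤ) + 1) ^ 2 * (q + 2) * q.factorial ^ 2 ≠ 0 := by
    have := Nat.factorial_pos q
    positivity
  apply mul_left_cancel₀ h0
  linear_combination 2 * h - (-1) ^ (r + 1) * ((r : ℤ) + 1) * (r + 2) * (r + 3) *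
    (q.factorial : ℤ) ^ 2 * (((q : ℤ) + 1) * (q + 2) * h2 + (q + 1) ^ 2 * h1 + 2 * h3)

/-! ### Products of basis functions -/

theorem choose_succ_mul_add_eq (i j s : ℕ) (hs : s ≤ j) :
    ((j + 1).choose (s + 1) : ℤ) * (i + j + 1) = j.choose s * (i + s + 1)
      + j.choose (s + 1) * (i + (s + 1) + j + 1) := by
  have h := Nat.choose_succ_right_eq j s
  rw [Nat.choose_succ_succ]
  have h' : (j.choose (s + 1) : ℤ) * (s + 1) = j.choose s * (j - s) := by
    rw [← Nat.cast_sub hs]; exact_mod_cast h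
  push_cast
  linear_combination (-1 : ℤ) * h'

theorem cast_descFactorial_succ (i t : ℕ) :
    (i.descFactorial (t + 1) : ℤ) = (i - t) * i.descFactorial t := by
  rw [Nat.descFactorial_succ]
  rcases le_or_gt t i with h | h
  · push_cast [Nat.cast_sub h]; ring
  · rw [Nat.descFactorial_of_lt h]; simp

/-- The coefficients of the expansion of `pronicProd i * pronicProd j`. -/
def pronicProdCoeff (i j s : ℕ) : ℤ :=
  j.choose s * i.descFactorial (j - s) * (i + j).descFactorial (j - s)

theorem pronicProdCoeff_succ_zero (i j : ℕ) :
    pronicProdCoeff i (j + 1) 0 = (i - j) * (i + j + 1) * pronicProdCoeff i j 0 := by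
  simp only [pronicProdCoeff, Nat.sub_zero, Nat.choose_zero_right]
  rw [← add_assoc, Nat.succ_descFactorial_succ, cast_descFactorial_succ]
  push_cast; ring

theorem pronicProdCoeff_succ_succ (i j s : ℕ) (hs : s ≤ j) :
    pronicProdCoeff i (j + 1) (s + 1) = pronicProdCoeff i j s
      + (i + (s + 1) - j) * (i + (s + 1) + j + 1) * pronicProdCoeff i j (s + 1) := by
  simp only [pronicProdCoeff]
  have h := choose_succ_mul_add_eq i j s hs
  rcases hs.eq_or_lt with rfl | hlt
  · simp
  obtain ⟨t, rfl⟩ := Nat.exists_eq_add_of_lt hlt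
  rw [show s + t + 1 + 1 - (s + 1) = t + 1 by omega, show s + t + 1 - s = t + 1 by omega,
    show s + t + 1 - (s + 1) = t by omega, ← add_assoc i (s + t + 1) 1,
    Nat.succ_descFactorial_succ, cast_descFactorial_succ, cast_descFactorial_succ]
  push_cast at h ⊢
  linear_combination ((i : ℤ) - t) * i.descFactorial t * (i + (s + t + 1)).descFactorial t * h

theorem pronicProd_mul_pronicProd (i j k : ℕ) :
    pronicProd i k * pronicProd j k
      = ∑ s ∈ Finset.range (j + 1), pronicProdCoeff i j s * pronicProd (i + s) k := by
  induction j with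
  | zero => simp [pronicProd, pronicProdCoeff]
  | succ j ih =>
    -- The new factor k(k+1) - j(j+1) is split at (i+s)(i+s+1): one part raises the index, the other
    -- is constant in k.
    have hstep (s : ℕ) : pronicProd (i + s) k * (((k : ℤ) - j) * (k + j + 1))
        = pronicProd (i + (s + 1)) k
          + (i + s - j) * (i + s + j + 1) * pronicProd (i + s) k := by
      rw [← add_assoc, pronicProd_succ]; push_cast; ring
    have htop : pronicProdCoeff i j (j + 1) = 0 := by simp [pronicProdCoeff]
    have hext : ∑ s ∈ Finset.range (j + 1), pronicProdCoeff i j s *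
        (((i : ℤ) + s - j) * (i + s + j + 1) * pronicProd (i + s) k)
        = ∑ s ∈ Finset.range (j + 1), pronicProdCoeff i j (s + 1) *
          (((i : ℤ) + (s + 1 : ℕ) - j) * (i + (s + 1 : ℕ) + j + 1) * pronicProd (i + (s + 1)) k)
          + pronicProdCoeff i j 0 * (((i : ℤ) - j) * (i + j + 1) * pronicProd i k) := by
      have h := Finset.sum_range_succ (fun s : ℕ => pronicProdCoeff i j s *
        (((i : ℤ) + s - j) * (i + s + j + 1) * pronicProd (i + s) k)) (j + 1)
      rw [htop, zero_mul, add_zero, Finset.sum_range_succ'] at h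
      rw [← h]; simp
    rw [pronicProd_succ, ← mul_assoc, ih, Finset.sum_mul, Finset.sum_range_succ' _ (j + 1),
      pronicProdCoeff_succ_zero]
    simp_rw [mul_assoc (pronicProdCoeff _ _ _), hstep, mul_add (pronicProdCoeff _ _ _)]
    rw [Finset.sum_add_distrib, hext, ← add_assoc, ← Finset.sum_add_distrib]
    congr 1
    · refine Finset.sum_congr rfl fun s hs => ?_
      rw [pronicProdCoeff_succ_succ i j s (Nat.lt_succ_iff.1 (Finset.mem_range.1 hs))]
      push_cast; ring
    · simp only [add_zero]; ring

/-- With X the right side and l = p+q+d, l+1 divides pX, qX and dX, while 1 = (l+1) - p - q - d. -/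
theorem schroderCoeff_mul_aux (p q d : ℕ) :
    ((p + q + d : ℕ) + 1 : ℤ) ∣ (p + q + d + d).choose d * (p + q + d + 1).choose p *
      (p + q + d + 1).choose q := by
  set l := p + q + d with hl
  set X : ℤ := (l + d).choose d * (l + 1).choose p * (l + 1).choose q with hX
  have key (r : ℕ) : ((l : ℤ) + 1) ∣ r * (l + 1).choose r := by
    rcases r with _ | r
    · simp
    · refine ⟨l.choose r, ?_⟩
      have := Nat.add_one_mul_choose_eq l r
      rw [mul_comm]; exact_mod_cast this.symm
  have hp : ((l : ℤ) + 1) ∣ p * X := by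
    rw [show p * X = (p * (l + 1).choose p) * ((l + d).choose d * (l + 1).choose q) by
      rw [hX]; ring]
    exact (key p).mul_right _
  have hq : ((l : ℤ) + 1) ∣ q * X := by
    rw [show q * X = (q * (l + 1).choose q) * ((l + d).choose d * (l + 1).choose p) by
      rw [hX]; ring]
    exact (key q).mul_right _
  have hd : ((l : ℤ) + 1) ∣ d * X := by
    have : ((l : ℤ) + 1) ∣ d * (l + d).choose d := by
      rcases d with _ | d
      · simp
      · refine ⟨(l + (d + 1)).choose d, ?_⟩
        have := Nat.choose_succ_right_eq (l + (d + 1)) d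
        rw [show l + (d + 1) - d = l + 1 by omega] at this
        rw [mul_comm, mul_comm ((l : ℤ) + 1)]; exact_mod_cast this
    rw [show d * X = (d * (l + d).choose d) * ((l + 1).choose p * (l + 1).choose q) by
      rw [hX]; ring]
    exact this.mul_right _
  have : X = (l + 1) * X - p * X - q * X - d * X := by
    rw [show (l : ℤ) = p + q + d by rw [hl]; push_cast; ring]; ring
  rw [this]
  exact (((dvd_mul_right _ _).sub hp).sub hq).sub hd

/-- Integrality of the structure constants: for j = s+d, i = q+d and l = s+q+d, the quotient is
binom(l+d,d) binom(l+1,s) binom(l+1,q)/(l+1). -/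
theorem dvd_pronicProdCoeff_mul (i j s : ℕ) (hs : s ≤ j) :
    (((i.factorial * (i + 1).factorial) * (j.factorial * (j + 1).factorial) : ℕ) : ℤ) ∣
      pronicProdCoeff i j s * (((i + s).factorial * (i + s + 1).factorial : ℕ) : ℤ) := by
  obtain ⟨d, rfl⟩ := Nat.exists_eq_add_of_le hs
  rw [pronicProdCoeff, show s + d - s = d by omega]
  rcases lt_or_ge i d with hi | hi
  · rw [Nat.descFactorial_of_lt hi]; simp
  obtain ⟨q, rfl⟩ := Nat.exists_eq_add_of_le' hi
  obtain ⟨c, hc⟩ := schroderCoeff_mul_aux s q d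
  refine ⟨c, ?_⟩
  have e1 : ((s + d).choose s : ℤ) * s.factorial * d.factorial = (s + d).factorial := by
    exact_mod_cast by
      simpa using Nat.choose_mul_factorial_mul_factorial (show s ≤ s + d by omega)
  have e2 : (q.factorial : ℤ) * (q + d).descFactorial d = (q + d).factorial := by
    exact_mod_cast by
      simpa using Nat.factorial_mul_descFactorial (show d ≤ q + d by omega)
  have e3 : ((s + q + d).factorial : ℤ) * (s + q + d + d).descFactorial d
      = (s + q + d + d).factorial := by
    exact_mod_cast by
      simpa using Nat.factorial_mul_descFactorial (show d ≤ s + q + d + d by omega)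
  have e4 : ((s + q + d + d).choose d : ℤ) * d.factorial * (s + q + d).factorial
      = (s + q + d + d).factorial := by
    exact_mod_cast by
      simpa using Nat.choose_mul_factorial_mul_factorial (show d ≤ s + q + d + d by omega)
  have e5 : ((s + q + d + 1).choose s : ℤ) * s.factorial * (q + d + 1).factorial
      = (s + q + d + 1).factorial := by
    have := Nat.choose_mul_factorial_mul_factorial (show s ≤ s + q + d + 1 by omega)
    rw [show s + q + d + 1 - s = q + d + 1 by omega] at this
    exact_mod_cast this
  have e6 : ((s + q + d + 1).choose q : ℤ) * q.factorial * (s + d + 1).factorial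
      = (s + q + d + 1).factorial := by
    have := Nat.choose_mul_factorial_mul_factorial (show q ≤ s + q + d + 1 by omega)
    rw [show s + q + d + 1 - q = s + d + 1 by omega] at this
    exact_mod_cast this
  have e7 : ((s + q + d + 1).factorial : ℤ) = ((s + q + d : ℕ) + 1) * (s + q + d).factorial := by
    rw [Nat.factorial_succ]; push_cast; ring
  rw [show q + d + (s + d) = s + q + d + d by ring, show q + d + s = s + q + d by ring]
  have e3' : ((s + q + d + d).descFactorial d : ℤ) = (s + q + d + d).choose d * d.factorial := by
    have : ((s + q + d).factorial : ℤ) ≠ 0 := by positivity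
    apply mul_left_cancel₀ this
    rw [e3, ← e4]; ring
  rw [Nat.cast_mul, Nat.cast_mul, Nat.cast_mul, Nat.cast_mul, e3', ← e1, ← e2]
  have h0 : (((s + q + d : ℕ) : ℤ) + 1) * s.factorial * q.factorial ≠ 0 := by positivity
  apply mul_left_cancel₀ h0
  trans ((s + d).choose s : ℤ) * s.factorial * d.factorial *
    (q.factorial * (q + d).descFactorial d) * (s + q + d + d).choose d *
    (s + q + d + 1).factorial * (s + q + d + 1).factorial
  · nth_rw 2 [e7]; ring
  · nth_rw 1 [← e5]
    rw [← e6]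
    linear_combination ((s + d).choose s : ℤ) * s.factorial * d.factorial *
      (q.factorial * (q + d).descFactorial d) * (s.factorial * q.factorial *
      (q + d + 1).factorial * (s + d + 1).factorial) * hc

theorem exists_schroderCoeff_mul_eq (i j : ℕ) : ∃ c : ℕ → ℤ, ∀ k,
    schroderCoeff i k * schroderCoeff j k
      = ∑ s ∈ Finset.range (j + 1), c s * schroderCoeff (i + s) k := by
  have h (s : ℕ) (hs : s ∈ Finset.range (j + 1)) :=
    dvd_pronicProdCoeff_mul i j s (Nat.lt_succ_iff.1 (Finset.mem_range.1 hs))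
  choose! c hc using h
  refine ⟨c, fun k => ?_⟩
  have h0 : (((i.factorial * (i + 1).factorial) * (j.factorial * (j + 1).factorial) : ℕ) : ℤ) ≠ 0 := by
    positivity
  apply mul_left_cancel₀ h0
  trans pronicProd i k * pronicProd j k
  · rw [← factorial_mul_schroderCoeff, ← factorial_mul_schroderCoeff]; push_cast; ring
  · rw [pronicProd_mul_pronicProd, Finset.mul_sum]
    refine Finset.sum_congr rfl fun s hs => ?_
    rw [← factorial_mul_schroderCoeff, ← mul_assoc, hc s hs, mul_assoc]

/-- The parity argument for squares needs these coefficients explicitly. -/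
theorem schroderCoeff_sq (i k : ℕ) :
    schroderCoeff i k ^ 2 = ∑ s ∈ Finset.range (i + 1),
      (catalan i * i.choose s * (i + s + 1).choose s : ℤ) * schroderCoeff (i + s) k := by
  have h0 : (((i.factorial * (i + 1).factorial) * (i.factorial * (i + 1).factorial) : ℕ) : ℤ) ≠ 0 := by
    positivity
  apply mul_left_cancel₀ h0
  trans pronicProd i k * pronicProd i k
  · rw [← factorial_mul_schroderCoeff]; push_cast; ring
  · rw [pronicProd_mul_pronicProd, Finset.mul_sum]
    refine Finset.sum_congr rfl fun s hs => ?_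
    obtain ⟨d, rfl⟩ := Nat.exists_eq_add_of_le (Nat.lt_succ_iff.1 (Finset.mem_range.1 hs))
    rw [← factorial_mul_schroderCoeff, pronicProdCoeff, show s + d - s = d by omega]
    have e2 : (s.factorial : ℤ) * (s + d).descFactorial d = (s + d).factorial := by
      exact_mod_cast by
        simpa using Nat.factorial_mul_descFactorial (show d ≤ s + d by omega)
    have e3 : ((s + d + s).factorial : ℤ) * (s + d + (s + d)).descFactorial d
        = (2 * (s + d)).factorial := by
      have := Nat.factorial_mul_descFactorial (show d ≤ s + d + (s + d) by omega)
      rw [show s + d + (s + d) - d = s + d + s by omega] at this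
      rw [two_mul]; exact_mod_cast this
    have e4 : ((s + d).factorial : ℤ) * (s + d + 1).factorial * catalan (s + d)
        = (2 * (s + d)).factorial := by
      exact_mod_cast factorial_mul_catalan (s + d)
    have e5 : ((s + d + s + 1).choose s : ℤ) * s.factorial * (s + d + 1).factorial
        = (s + d + s + 1).factorial := by
      have := Nat.choose_mul_factorial_mul_factorial (show s ≤ s + d + s + 1 by omega)
      rw [show s + d + s + 1 - s = s + d + 1 by omega] at this
      exact_mod_cast this
    rw [Nat.cast_mul, Nat.cast_mul, Nat.cast_mul, ← e5]
    trans ((s + d).choose s : ℤ) * ((s.factorial : ℤ) * (s + d).descFactorial d) *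
      (((s + d + s).factorial : ℤ) * (s + d + (s + d)).descFactorial d) *
      ((s + d + s + 1).choose s * (s + d + 1).factorial) * schroderCoeff (s + d + s) k
    · ring
    · rw [e2, e3, ← e4]; ring

/-! ### The span and reduction to basis functions -/

/-- The function `k ↦ binom(k+i, 2i) C_i`, with values in `ℤ[x]`. -/
noncomputable def schroderFun (i : ℕ) : ℕ → ℤ[X] := fun k => (schroderCoeff i k : ℤ[X])

/-- The `ℤ[x]`-module of functions spanned by the functions `k ↦ binom(k+i, 2i) C_i`. -/
noncomputable def schroderSpan : Submodule ℤ[X] (ℕ → ℤ[X]) :=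
  Submodule.span ℤ[X] (Set.range schroderFun)

theorem schroderFun_mem (i : ℕ) : schroderFun i ∈ schroderSpan :=
  Submodule.subset_span ⟨i, rfl⟩

theorem schroderFun_zero : schroderFun 0 = 1 := by
  funext k; simp [schroderFun, schroderCoeff]

theorem two_mul_schroderFun_one (k : ℕ) : 2 * schroderFun 1 k = (k : ℤ[X]) * (k + 1) := by
  have h := factorial_mul_schroderCoeff 1 k
  simp only [pronicProd, Finset.prod_range_one] at h
  simp at h
  rw [schroderFun]
  exact_mod_cast congrArg (Int.cast : ℤ → ℤ[X]) h

theorem one_mem_schroderSpan : (1 : ℕ → ℤ[X]) ∈ schroderSpan :=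
  schroderFun_zero ▸ schroderFun_mem 0

theorem schroderFun_mul_mem (i j : ℕ) : schroderFun i * schroderFun j ∈ schroderSpan := by
  obtain ⟨c, hc⟩ := exists_schroderCoeff_mul_eq i j
  have : schroderFun i * schroderFun j
      = ∑ s ∈ Finset.range (j + 1), (c s : ℤ[X]) • schroderFun (i + s) := by
    funext k
    simp only [Pi.mul_apply, schroderFun, Finset.sum_apply, Pi.smul_apply, smul_eq_mul]
    exact_mod_cast congrArg (Int.cast : ℤ → ℤ[X]) (hc k)
  rw [this]
  exact Submodule.sum_mem _ fun s _ => Submodule.smul_mem _ _ (schroderFun_mem _)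

theorem mul_mem_schroderSpan {f g : ℕ → ℤ[X]} (hf : f ∈ schroderSpan) (hg : g ∈ schroderSpan) :
    f * g ∈ schroderSpan := by
  have : schroderSpan * schroderSpan ≤ schroderSpan := by
    rw [schroderSpan, Submodule.span_mul_span, Submodule.span_le]
    rintro _ ⟨_, ⟨i, rfl⟩, _, ⟨j, rfl⟩, rfl⟩
    exact schroderFun_mul_mem i j
  exact this (Submodule.mul_mem_mul hf hg)

theorem pow_mem_schroderSpan {f : ℕ → ℤ[X]} (hf : f ∈ schroderSpan) (m : ℕ) :
    f ^ m ∈ schroderSpan := by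
  induction m with
  | zero => rw [pow_zero]; exact one_mem_schroderSpan
  | succ m ih => rw [pow_succ]; exact mul_mem_schroderSpan ih hf

/-- Terms with i > k vanish because h > 0, so one sum up to n serves every k ≤ n. -/
theorem exists_mem_schroderSpan_eq_genSchroderPoly (h n : ℕ) (hh : 0 < h) :
    ∃ f ∈ schroderSpan, ∀ k ≤ n, f k = genSchroderPoly h k := by
  refine ⟨∑ i ∈ Finset.range (n + 1), (X ^ i : ℤ[X]) • schroderFun i ^ h,
    Submodule.sum_mem _ fun i _ => Submodule.smul_mem _ _
      (pow_mem_schroderSpan (schroderFun_mem i) h), fun k hk => ?_⟩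
  rw [genSchroderPoly, Finset.sum_apply]
  symm
  trans ∑ i ∈ Finset.range (k + 1), ((X ^ i : ℤ[X]) • schroderFun i ^ h) k
  · refine Finset.sum_congr rfl fun i _ => ?_
    simp [schroderFun, schroderCoeff, mul_pow, mul_comm]
  · refine Finset.sum_subset (by simpa using hk) fun i _ hi => ?_
    rw [Finset.mem_range, not_lt] at hi
    simp [schroderFun, schroderCoeff, Nat.choose_eq_zero_of_lt (show k + i < 2 * i by omega), hh.ne']

/-- The weighted sum `∑_{k ≤ n} ε^k k(k+1)(2k+1) f(k)`. -/
noncomputable def pronicSum (ε : ℤ) (n : ℕ) : (ℕ → ℤ[X]) →ₗ[ℤ[X]] ℤ[X] :=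
  ∑ k ∈ Finset.range (n + 1),
    ((ε ^ k * ((k : ℤ) * (k + 1) * (2 * k + 1)) : ℤ) : ℤ[X]) • LinearMap.proj k

theorem pronicSum_apply (ε : ℤ) (n : ℕ) (f : ℕ → ℤ[X]) : pronicSum ε n f =
    ∑ k ∈ Finset.range (n + 1), ((ε ^ k * ((k : ℤ) * (k + 1) * (2 * k + 1)) : ℤ) : ℤ[X]) * f k := by
  simp [pronicSum, LinearMap.sum_apply]

theorem pronicSum_schroderFun (ε : ℤ) (n i : ℕ) : pronicSum ε n (schroderFun i) =
    ((∑ k ∈ Finset.range (n + 1),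
      ε ^ k * ((k : ℤ) * (k + 1) * (2 * k + 1)) * schroderCoeff i k : ℤ) : ℤ[X]) := by
  rw [pronicSum_apply]; push_cast; rfl

/-- The product `n (n + 1) (n + 2)`. -/
def tripleProd (n : ℕ) : ℤ := (n : ℤ) * (n + 1) * (n + 2)

theorem dvd_mul_pronicSum_of_mem {ε c : ℤ} {n : ℕ}
    (H : ∀ i, tripleProd n ∣ c * ∑ k ∈ Finset.range (n + 1),
      ε ^ k * ((k : ℤ) * (k + 1) * (2 * k + 1)) * schroderCoeff i k)
    {f : ℕ → ℤ[X]} (hf : f ∈ schroderSpan) :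
    (tripleProd n : ℤ[X]) ∣ (c : ℤ[X]) * pronicSum ε n f := by
  induction hf using Submodule.span_induction with
  | mem x hx =>
    obtain ⟨i, rfl⟩ := hx
    rw [pronicSum_schroderFun]
    exact_mod_cast (Int.castRingHom ℤ[X]).map_dvd (H i)
  | zero => simp
  | add x y _ _ hx hy => rw [map_add, mul_add]; exact dvd_add hx hy
  | smul p x _ hx => rw [map_smul, smul_eq_mul, mul_left_comm]; exact hx.mul_left _

theorem dvd_gcd_mul_pronicSum_one {n : ℕ} {f : ℕ → ℤ[X]} (hf : f ∈ schroderSpan) :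
    (tripleProd n : ℤ[X]) ∣ ((Nat.gcd 2 n : ℕ) : ℤ[X]) * pronicSum 1 n f := by
  have := dvd_mul_pronicSum_of_mem (ε := 1) (c := (Nat.gcd 2 n : ℕ)) (n := n)
    (fun i => by simpa [tripleProd] using dvd_gcd_mul_sum_schroderCoeff i n) hf
  exact_mod_cast this

theorem two_mul_alternating_sum_schroderCoeff' (i r : ℕ) :
    2 * ∑ k ∈ Finset.range (r + 1 + 1),
        (-1) ^ k * ((k : ℤ) * (k + 1) * (2 * k + 1)) * schroderCoeff i k
      = tripleProd (r + 1) * ((-1) ^ (r + 1) *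
        (alternatingWeight r i + alternatingWeight r (i + 1))) := by
  rw [two_mul_alternating_sum_schroderCoeff, tripleProd]; push_cast; ring

theorem dvd_two_mul_pronicSum_neg_one {r : ℕ} {f : ℕ → ℤ[X]} (hf : f ∈ schroderSpan) :
    (tripleProd (r + 1) : ℤ[X]) ∣ 2 * pronicSum (-1) (r + 1) f := by
  have := dvd_mul_pronicSum_of_mem (ε := -1) (c := 2) (n := r + 1)
    (fun i => ⟨_, two_mul_alternating_sum_schroderCoeff' i r⟩) hf
  exact_mod_cast this

theorem dvd_of_two_mul_eq {a x y : ℤ} (h : 2 * x = a * y) (hy : 2 ∣ y) : a ∣ x := by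
  obtain ⟨c, rfl⟩ := hy
  exact ⟨c, by linarith⟩

theorem dvd_pronicSum_neg_one_of_even {r : ℕ} (hr : Even r) {f : ℕ → ℤ[X]}
    (hf : f ∈ schroderSpan) : (tripleProd (r + 1) : ℤ[X]) ∣ pronicSum (-1) (r + 1) f := by
  have := dvd_mul_pronicSum_of_mem (ε := -1) (c := 1) (n := r + 1)
    (fun i => by
      rw [one_mul]
      exact dvd_of_two_mul_eq (two_mul_alternating_sum_schroderCoeff' i r)
        ((dvd_add (even_alternatingWeight_of_even hr _)
          (even_alternatingWeight_of_even hr _)).mul_left _)) hf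
  simpa using this

/-! ### Squares in the alternating sum -/

theorem dvd_sum_range_two_mul {a : ℤ} {f : ℕ → ℤ} (h : ∀ t, a ∣ f (2 * t) + f (2 * t + 1)) (q : ℕ) :
    a ∣ ∑ s ∈ Finset.range (2 * q), f s := by
  induction q with
  | zero => simp
  | succ q ih =>
    rw [show 2 * (q + 1) = 2 * q + 1 + 1 by ring, Finset.sum_range_succ, Finset.sum_range_succ,
      add_assoc]
    exact dvd_add ih (h q)

/-- Passing from 2t to 2t+1 multiplies each binomial by a ratio of odd numbers, so both products
have the same parity. -/
theorem even_choose_mul_choose_add {i : ℕ} (hi : Odd i) (t : ℕ) :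
    Even ((i.choose (2 * t) * (i + 2 * t + 1).choose (2 * t))
      + i.choose (2 * t + 1) * (i + (2 * t + 1) + 1).choose (2 * t + 1)) := by
  have h1 := Nat.choose_succ_right_eq i (2 * t)
  have h2 := Nat.add_one_mul_choose_eq (i + 2 * t + 1) (2 * t)
  have h3 : Even (i.choose (2 * t + 1)) ↔ Even (i.choose (2 * t)) := by
    rcases lt_or_ge i (2 * t) with h | h
    · rw [Nat.choose_eq_zero_of_lt h, Nat.choose_eq_zero_of_lt (by omega)]
    · have := congrArg Even h1
      rw [Nat.even_mul, Nat.even_mul] at this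
      grind
  have h4 : Even ((i + 2 * t + 1 + 1).choose (2 * t + 1)) ↔ Even ((i + 2 * t + 1).choose (2 * t)) := by
    have := congrArg Even h2
    rw [Nat.even_mul, Nat.even_mul] at this
    grind
  rw [show i + (2 * t + 1) + 1 = i + 2 * t + 1 + 1 by ring, Nat.even_add, Nat.even_mul, Nat.even_mul,
    h3, h4]

theorem two_dvd_sum_alternatingWeight (r i : ℕ) :
    (2 : ℤ) ∣ ∑ s ∈ Finset.range (i + 1), (catalan i * i.choose s * (i + s + 1).choose s : ℤ) *
      (alternatingWeight r (i + s) + alternatingWeight r (i + s + 1)) := by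
  rcases Nat.even_or_odd i with hi | hi
  · rcases eq_or_ne i 0 with rfl | h0
    · simp [alternatingWeight]
    · have : (2 : ℤ) ∣ catalan i := by exact_mod_cast even_iff_two_dvd.1 (even_catalan hi h0)
      exact Finset.dvd_sum fun s _ => ((this.mul_right _).mul_right _).mul_right _
  · obtain ⟨q, rfl⟩ := id hi
    rw [show 2 * q + 1 + 1 = 2 * (q + 1) by ring]
    -- Pair s = 2t with s = 2t+1: the outer weights have odd index, hence are even, and the shared
    -- middle weight has an even total coefficient.
    refine dvd_sum_range_two_mul (fun t => ?_) (q + 1)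
    set i := 2 * q + 1 with hi'
    obtain ⟨w, hw⟩ := even_alternatingWeight_of_odd r (i := i + 2 * t) (by grind)
    obtain ⟨v, hv⟩ := even_alternatingWeight_of_odd r (i := i + (2 * t + 1) + 1) (by grind)
    obtain ⟨e, he⟩ := even_choose_mul_choose_add hi t
    have he' : (i.choose (2 * t) * (i + 2 * t + 1).choose (2 * t)
      + i.choose (2 * t + 1) * (i + (2 * t + 1) + 1).choose (2 * t + 1) : ℤ) = e + e := by
      exact_mod_cast he
    rw [hw, hv, show i + (2 * t + 1) = i + 2 * t + 1 by ring] at *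
    refine ⟨catalan i * (i.choose (2 * t) * (i + 2 * t + 1).choose (2 * t) * w
      + i.choose (2 * t + 1) * (i + 2 * t + 1 + 1).choose (2 * t + 1) * v
      + e * alternatingWeight r (i + 2 * t + 1)), ?_⟩
    linear_combination (catalan i * alternatingWeight r (i + 2 * t + 1) : ℤ) * he'

theorem dvd_pronicSum_neg_one_schroderFun_sq (r i : ℕ) :
    (tripleProd (r + 1) : ℤ[X]) ∣ pronicSum (-1) (r + 1) (schroderFun i ^ 2) := by
  have : pronicSum (-1) (r + 1) (schroderFun i ^ 2) =
      ((∑ k ∈ Finset.range (r + 1 + 1),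
        (-1) ^ k * ((k : ℤ) * (k + 1) * (2 * k + 1)) * schroderCoeff i k ^ 2 : ℤ) : ℤ[X]) := by
    rw [pronicSum_apply]; push_cast; rfl
  rw [this]
  refine (Int.castRingHom ℤ[X]).map_dvd (dvd_of_two_mul_eq (y := (-1) ^ (r + 1) * _) ?_
    ((two_dvd_sum_alternatingWeight r i).mul_left _))
  simp_rw [schroderCoeff_sq, Finset.mul_sum]
  rw [Finset.sum_comm]
  refine Finset.sum_congr rfl fun s _ => ?_
  have h := two_mul_alternating_sum_schroderCoeff' (i + s) r
  rw [mul_left_comm ((-1) ^ (r + 1)), mul_left_comm (tripleProd _), ← h, Finset.mul_sum,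
    Finset.mul_sum]
  exact Finset.sum_congr rfl fun k _ => by ring

/-- The cross term 2xy carries the factor 2 that suffices for any element of the span. -/
theorem dvd_pronicSum_neg_one_sq {r : ℕ} {f : ℕ → ℤ[X]} (hf : f ∈ schroderSpan) :
    (tripleProd (r + 1) : ℤ[X]) ∣ pronicSum (-1) (r + 1) (f ^ 2) := by
  induction hf using Submodule.span_induction with
  | mem x hx =>
    obtain ⟨i, rfl⟩ := hx
    exact dvd_pronicSum_neg_one_schroderFun_sq r i
  | zero => simp
  | add x y hx' hy' hx hy =>
    have : (x + y) ^ 2 = x ^ 2 + y ^ 2 + (2 : ℤ[X]) • (x * y) := by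
      funext k; simp only [Pi.add_apply, Pi.pow_apply, Pi.mul_apply, Pi.smul_apply, smul_eq_mul]; ring
    rw [this, map_add, map_add, map_smul, smul_eq_mul]
    exact dvd_add (dvd_add hx hy) (dvd_two_mul_pronicSum_neg_one (mul_mem_schroderSpan hx' hy'))
  | smul p x _ hx =>
    rw [_root_.smul_pow, map_smul, smul_eq_mul]; exact hx.mul_left _

/-! ### Assembly and passage to rational coefficients -/

/-- The function `k ↦ k (k + 1)`. -/
noncomputable def pronicFun : ℕ → ℤ[X] := fun k => (k : ℤ[X]) * (k + 1)

theorem pronicFun_eq : pronicFun = (2 : ℤ[X]) • schroderFun 1 := by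
  funext k; exact (two_mul_schroderFun_one k).symm

theorem dvd_gcd_mul_pronicSum_neg_one {f : ℕ → ℤ[X]} (hf : f ∈ schroderSpan) {m n : ℕ}
    (hm : 0 < m) (hn : 0 < n) (b : ℕ) :
    (tripleProd n : ℤ[X]) ∣ ((Nat.gcd 2 (Nat.gcd (m - 1) n) : ℕ) : ℤ[X]) *
      pronicSum (-1) n (pronicFun ^ b * f ^ m) := by
  obtain ⟨r, rfl⟩ : ∃ r, n = r + 1 := ⟨n - 1, by omega⟩
  have hy : pronicFun ∈ schroderSpan := by
    rw [pronicFun_eq]; exact Submodule.smul_mem _ _ (schroderFun_mem 1)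
  have hmem := pow_mem_schroderSpan hf m
  rcases Nat.even_or_odd r with hr | hr
  · exact (dvd_pronicSum_neg_one_of_even hr
      (mul_mem_schroderSpan (pow_mem_schroderSpan hy b) hmem)).mul_left _
  rcases Nat.even_or_odd m with h | h
  · refine Dvd.dvd.mul_left ?_ _
    rcases b with _ | b
    · obtain ⟨q, rfl⟩ := h
      rw [pow_zero, one_mul, ← mul_two, pow_mul]
      exact dvd_pronicSum_neg_one_sq (pow_mem_schroderSpan hf q)
    -- One factor k(k+1) = 2 · `schroderFun 1` supplies the 2.
    · rw [pow_succ', mul_assoc, pronicFun_eq, smul_mul_assoc, map_smul, smul_eq_mul, ← pronicFun_eq]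
      exact dvd_two_mul_pronicSum_neg_one (mul_mem_schroderSpan (schroderFun_mem 1)
        (mul_mem_schroderSpan (pow_mem_schroderSpan hy b) hmem))
  · have h2 : 2 ∣ Nat.gcd (m - 1) (r + 1) := Nat.dvd_gcd (by grind) (by grind)
    rw [Nat.gcd_eq_left h2]
    exact_mod_cast dvd_two_mul_pronicSum_neg_one
      (mul_mem_schroderSpan (pow_mem_schroderSpan hy b) hmem)

theorem C_div_mul_map_mem_intPolySubring {g n : ℕ} (hn : 0 < n) {p : ℤ[X]}
    (h : (tripleProd n : ℤ[X]) ∣ (g : ℤ[X]) * p) :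
    C ((g : ℚ) / ((n : ℚ) * ((n : ℚ) + 1) * ((n : ℚ) + 2))) * p.map (Int.castRingHom ℚ)
      ∈ intPolySubring := by
  obtain ⟨q, hq⟩ := h
  refine ⟨q, ?_⟩
  have h0 : (n : ℚ) * ((n : ℚ) + 1) * ((n : ℚ) + 2) ≠ 0 := by positivity
  have hq' := congrArg (Polynomial.map (Int.castRingHom ℚ)) hq
  simp only [Polynomial.map_mul, Polynomial.map_natCast, Polynomial.map_intCast] at hq'
  have ht : ((tripleProd n : ℤ) : ℚ[X]) = C ((n : ℚ) * ((n : ℚ) + 1) * ((n : ℚ) + 2)) := by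
    rw [← C_eq_intCast, tripleProd]; push_cast; rfl
  rw [div_eq_inv_mul, C_mul, mul_assoc, C_eq_natCast, hq', ht, ← mul_assoc, ← C_mul,
    inv_mul_cancel₀ h0, C_1, one_mul, coe_mapRingHom]

/-- One of the b+1 factors k(k+1) is the weight in `pronicSum`; this weight also kills the term k =
0. -/
theorem sum_Icc_eq_map_pronicSum (ε : ℤ) (h m n b : ℕ) {f : ℕ → ℤ[X]}
    (hf : ∀ k ≤ n, f k = genSchroderPoly h k) :
    ∑ k ∈ Finset.Icc 1 n, C ((ε : ℚ) ^ k * (k : ℚ) ^ (b + 1) * ((k : ℚ) + 1) ^ (b + 1) *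
        (2 * (k : ℚ) + 1)) * ((genSchroderPoly h k).map (Int.castRingHom ℚ)) ^ m
      = (pronicSum ε n (pronicFun ^ b * f ^ m)).map (Int.castRingHom ℚ) := by
  rw [pronicSum_apply, Polynomial.map_sum]
  have hsub : Finset.Icc 1 n ⊆ Finset.range (n + 1) := fun k hk => by
    rw [Finset.mem_Icc] at hk; rw [Finset.mem_range]; omega
  rw [← Finset.sum_subset hsub fun k hk hk' => ?_]
  · refine Finset.sum_congr rfl fun k hk => ?_
    rw [Pi.mul_apply, Pi.pow_apply, Pi.pow_apply, hf k (Finset.mem_Icc.1 hk).2, pronicFun]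
    simp only [Polynomial.map_mul, Polynomial.map_natCast, Polynomial.map_intCast,
      Polynomial.map_pow, Polynomial.map_add, Polynomial.map_one, Int.cast_mul, Int.cast_pow,
      Int.cast_natCast, Int.cast_add, Int.cast_one, Int.cast_ofNat, C_mul, C_pow, C_add, C_1,
      C_eq_natCast, C_eq_intCast, C_ofNat, Polynomial.map_ofNat, mul_pow]
    ring
  · have : k = 0 := by
      rw [Finset.mem_range] at hk; rw [Finset.mem_Icc] at hk'; omega
    simp [this]

theorem mainTheorem3 (h m n a : ℕ) (hh : 0 < h) (hm : 0 < m) (hn : 0 < n) (ha : 0 < a) :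
    C (((Nat.gcd 2 n : ℕ) : ℚ) / ((n : ℚ) * ((n : ℚ) + 1) * ((n : ℚ) + 2))) *
        ∑ k ∈ Finset.Icc 1 n,
          C ((k : ℚ) ^ a * ((k : ℚ) + 1) ^ a * (2 * (k : ℚ) + 1)) *
            ((genSchroderPoly h k).map (Int.castRingHom ℚ)) ^ m ∈ intPolySubring ∧
    C (((Nat.gcd 2 (Nat.gcd (m - 1) n) : ℕ) : ℚ) /
          ((n : ℚ) * ((n : ℚ) + 1) * ((n : ℚ) + 2))) *
        ∑ k ∈ Finset.Icc 1 n,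
          C ((-1 : ℚ) ^ k * (k : ℚ) ^ a * ((k : ℚ) + 1) ^ a * (2 * (k : ℚ) + 1)) *
            ((genSchroderPoly h k).map (Int.castRingHom ℚ)) ^ m ∈ intPolySubring := by
  obtain ⟨b, rfl⟩ : ∃ b, a = b + 1 := ⟨a - 1, by omega⟩
  obtain ⟨f, hf, hfS⟩ := exists_mem_schroderSpan_eq_genSchroderPoly h n hh
  have hy : pronicFun ∈ schroderSpan := by
    rw [pronicFun_eq]; exact Submodule.smul_mem _ _ (schroderFun_mem 1)
  have h1 := sum_Icc_eq_map_pronicSum 1 h m n b hfS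
  have h2 := sum_Icc_eq_map_pronicSum (-1) h m n b hfS
  simp only [Int.cast_one, one_pow, one_mul, Int.cast_neg] at h1 h2
  rw [h1, h2]
  exact ⟨C_div_mul_map_mem_intPolySubring hn (dvd_gcd_mul_pronicSum_one
      (mul_mem_schroderSpan (pow_mem_schroderSpan hy b) (pow_mem_schroderSpan hf m))),
    C_div_mul_map_mem_intPolySubring hn (dvd_gcd_mul_pronicSum_neg_one hf hm hn b)⟩
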